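/- Let $n\ge 1$, $0<\beta_1<\dots<\beta_n<1$ and $c_1,\dots,c_n>0$, and let $$\mu=\sum_{j=1}^n \frac{c_j^{\beta_j}}{\Gamma(1-\beta_j)}\,\delta_{\beta_j}.$$ Let $(W_\tau)_{\tau\ge 0}$ be a driftless subordinator whose Lévy measure $\phi_W$ on $(0,\infty)$ has the tails $$\phi_W(u,\infty)=\int_0^1 u^{-\beta}\,\mu(d\beta),\qquad u>0,$$ that is, $\mathbb{E}[e^{-sW_\tau}]=e^{-\tau\psi_W(s)}$ with $\psi_W(s)=\int_0^\infty(1-e^{-sx})\,\phi_W(dx)$ for $s,\tau\ge 0$. Let $E_t=\inf\{\tau\ge 0: W_\tau>t\}$ be its hitting time process and $h(t,\lambda)=\mathbb{E}[e^{-\lambda E_t}]$ the Laplace transform of $E_t$. Then for every $\lambda>0$ and every $t>0$ the derivative $\partial_t h(t,\lambda)$ exists, and $$\big|\partial_t h(t,\lambda)\big|\le \lambda\,\Big(c_j^{\beta_j}\sin(\beta_j\pi)\Big)^{-1}t^{\beta_j-1}\qquad\text{for every } j=1,\dots,n.$$ -/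

import Mathlib

open MeasureTheory ProbabilityTheory Set
open scoped NNReal ENNReal

noncomputable section

/-- The atomic measure `μ = ∑ⱼ cⱼ ^ βⱼ / Γ(1 - βⱼ) · δ_{βⱼ}` on the line. -/
def atomicMixingMeasure {n : ℕ} (β c : Fin n → ℝ) : Measure ℝ :=
  ∑ j, ENNReal.ofReal (c j ^ β j * (Real.Gamma (1 - β j))⁻¹) • Measure.dirac (β j)

/-- The Laplace exponent `ψ(s) = ∫_{(0,∞)} (1 - e^{-s x}) φ(dx)` of the driftless subordinator
with Lévy measure `φ`. -/
def laplaceExponent (φ : Measure ℝ) (s : ℝ) : ℝ :=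
  ∫ x in Ioi (0 : ℝ), (1 - Real.exp (-s * x)) ∂φ

/-- `φ` is the Lévy measure of a subordinator: it lives on `(0, ∞)` and
`∫ min(1, x) φ(dx) < ∞`. -/
structure IsSubordinatorLevyMeasure (φ : Measure ℝ) : Prop where
  null_nonpos : φ (Iic 0) = 0
  lintegral_min_lt_top : ∫⁻ x in Ioi (0 : ℝ), ENNReal.ofReal (min 1 x) ∂φ < ∞

/-- `W` is, under `P`, a (driftless) subordinator with Lévy measure `φ`: it starts at `0`, has
independent and stationary increments and nondecreasing right-continuous paths, and
`E[e^{-s W_t}] = e^{-t ψ(s)}` with `ψ` the Laplace exponent attached to `φ`. -/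
structure IsSubordinator {Ω : Type*} [MeasurableSpace Ω] (P : Measure Ω) (W : ℝ≥0 → Ω → ℝ)
    (φ : Measure ℝ) : Prop where
  levyMeasure : IsSubordinatorLevyMeasure φ
  measurable : ∀ t, Measurable (W t)
  zero : ∀ᵐ ω ∂P, W 0 ω = 0
  indepIncrements : HasIndepIncrements W P
  stationary : ∀ s t : ℝ≥0, IdentDistrib (fun ω => W (s + t) ω - W s ω) (W t) P P
  monotone : ∀ᵐ ω ∂P, Monotone fun t => W t ω
  rightContinuous : ∀ᵐ ω ∂P, ∀ t, ContinuousWithinAt (fun u => W u ω) (Ici t) t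
  laplace : ∀ (t : ℝ≥0) (s : ℝ), 0 ≤ s →
    ∫ ω, Real.exp (-s * W t ω) ∂P = Real.exp (-t * laplaceExponent φ s)

/-- The hitting time `E_t = inf {τ ≥ 0 : W_τ > t}`. -/
def hittingTimeProcess {Ω : Type*} (W : ℝ≥0 → Ω → ℝ) (t : ℝ) (ω : Ω) : ℝ :=
  ((sInf {τ : ℝ≥0 | t < W τ ω} : ℝ≥0) : ℝ)

/-- `h(t, lam) = E[e^{-lam E_t}]`, the Laplace transform of the hitting time `E_t`. -/
def hittingLaplace {Ω : Type*} [MeasurableSpace Ω] (P : Measure Ω) (W : ℝ≥0 → Ω → ℝ)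
    (t lam : ℝ) : ℝ :=
  ∫ ω, Real.exp (-lam * hittingTimeProcess W t ω) ∂P

/-- `k(t) = (c ^ β · sin (β π))⁻¹ · t ^ (β - 1)`. -/
def kernelBound (β c t : ℝ) : ℝ :=
  (c ^ β * Real.sin (β * Real.pi))⁻¹ * t ^ (β - 1)

end

/-! Write a_j = c_j ^ β_j. Integrating the prescribed tails by parts gives ψ(s) = ∑ a_j s^{β_j}. If
e is an exponential time of rate λ independent of W, then {W_e > t} and {e > E_t} agree up to a null
set, so h(t, λ) = P(W_e > t), and W_e has Laplace transform λ / (λ + ψ(s)).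

The function 1 / (λ + ψ) is a Stieltjes transform ∫ ν(dx) / (s + e^x) of a positive measure ν
(`exists_stieltjes_measure`). This comes from Cauchy's theorem: with s = e^w the slit plane becomes
the strip |Im w| ≤ π, whose two edges are the two sides of the cut, and every function involved is
single-valued there. By uniqueness of Laplace transforms W_e has density λ f with f(t) = ∫ e^{-t
e^x} ν(dx). Since f is continuous on (0, ∞), ∂_t h = -λ f
(`IsSubordinator.hasDerivAt_hittingLaplace`).

The bound needs no tail analysis of f: from e^{-y} ≤ 1 / (1 + y) with y = t e^x follows f(t) ≤ t⁻¹ /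
(λ + ψ(1/t)) ≤ t⁻¹ / (a_j t^{-β_j}) = a_j⁻¹ t^{β_j - 1}, which is stronger than the claim because
sin ≤ 1. -/

/-! ### Uniqueness of Laplace transforms on the half line -/

/-- The bounded continuous function `x ↦ e^{-x}` on `[0, ∞)`. -/
noncomputable def expNegBCF : BoundedContinuousFunction ℝ≥0 ℝ :=
  BoundedContinuousFunction.ofNormedAddCommGroup (fun x : ℝ≥0 => Real.exp (-(x : ℝ)))
    (by fun_prop) 1 (fun x => by
      rw [Real.norm_eq_abs, abs_of_pos (Real.exp_pos _)]
      exact Real.exp_le_one_iff.2 (by simp))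

@[simp] lemma expNegBCF_apply (x : ℝ≥0) : expNegBCF x = Real.exp (-(x : ℝ)) := rfl

/-- Finite measures on `[0, ∞)` are determined by their Laplace transforms at the integers. -/
theorem nnreal_measure_ext_of_integral_exp {μ ν : Measure ℝ≥0} [IsFiniteMeasure μ]
    [IsFiniteMeasure ν]
    (h : ∀ n : ℕ, ∫ x, Real.exp (-(n * (x : ℝ))) ∂μ = ∫ x, Real.exp (-(n * (x : ℝ))) ∂ν) :
    μ = ν := by
  have hpow : ∀ (n : ℕ) (x : ℝ≥0), (expNegBCF ^ n) x = Real.exp (-(n * (x : ℝ))) := by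
    intro n x
    rw [BoundedContinuousFunction.pow_apply, expNegBCF_apply, ← Real.exp_nat_mul]
    congr 1; ring
  -- Polynomials in e^{-x} form an algebra that separates points, and their integrals are
  -- combinations of the given transforms.
  let A : StarSubalgebra ℝ (BoundedContinuousFunction ℝ≥0 ℝ) :=
    { Algebra.adjoin ℝ {expNegBCF} with
      star_mem' := by
        intro f hf
        have : star f = f := by ext x; simp
        rw [this]; exact hf }
  refine ext_of_forall_mem_subalgebra_integral_eq_of_pseudoEMetric_complete_countable
    (𝕜 := ℝ) (A := A) ?_ ?_
  · intro x y hxy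
    refine ⟨expNegBCF, ⟨expNegBCF.toContinuousMap, ⟨expNegBCF, ?_, rfl⟩, rfl⟩, ?_⟩
    · exact Algebra.subset_adjoin (mem_singleton _)
    · simpa using hxy
  · intro g hg
    have hg' : g ∈ Algebra.adjoin ℝ {expNegBCF} := hg
    rw [Algebra.adjoin_singleton_eq_range_aeval] at hg'
    obtain ⟨p, rfl⟩ := hg'
    have key : ∀ (ρ : Measure ℝ≥0) [IsFiniteMeasure ρ],
        ∫ x, (Polynomial.aeval expNegBCF p) x ∂ρ
          = ∑ i ∈ p.support, p.coeff i * ∫ x, Real.exp (-(i * (x : ℝ))) ∂ρ := by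
      intro ρ _
      have : ∀ x, (Polynomial.aeval expNegBCF p) x
          = ∑ i ∈ p.support, p.coeff i * Real.exp (-(i * (x : ℝ))) := by
        intro x
        rw [Polynomial.aeval_def, Polynomial.eval₂_eq_sum,
          Polynomial.sum, BoundedContinuousFunction.sum_apply]
        refine Finset.sum_congr rfl fun i _ => ?_
        rw [← hpow i x]
        simp [Algebra.algebraMap_eq_smul_one]
      simp_rw [this]
      rw [integral_finsetSum]
      · simp_rw [integral_const_mul]
      · intro i _
        have := ((expNegBCF ^ i).integrable ρ).const_mul (p.coeff i)
        simpa only [hpow] using this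
    refine (key μ).trans (Eq.trans ?_ (key ν).symm)
    simp_rw [h]

/-- Measures on the half line are determined by their Laplace transforms at the positive
integers. -/
theorem measure_ext_of_lintegral_exp {μ ν : Measure ℝ} (hμ : μ (Iio 0) = 0) (hν : ν (Iio 0) = 0)
    (hfin : ∫⁻ x, ENNReal.ofReal (Real.exp (-x)) ∂μ ≠ ∞)
    (h : ∀ n : ℕ, ∫⁻ x, ENNReal.ofReal (Real.exp (-((n + 1) * x))) ∂μ
      = ∫⁻ x, ENNReal.ofReal (Real.exp (-((n + 1) * x))) ∂ν) : μ = ν := by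
  -- The weight e^{-x} makes both measures finite and shifts the exponents n + 1 to n. It never
  -- vanishes, so it can be divided out at the end.
  set f : ℝ → ℝ≥0∞ := fun x => ENNReal.ofReal (Real.exp (-x)) with hf
  have hfm : Measurable f := by fun_prop
  have hf0 : ∀ x, f x ≠ 0 := fun x => by simp [hf, Real.exp_pos]
  have hft : ∀ x, f x ≠ ∞ := fun x => by simp [hf]
  have hfinν : ∫⁻ x, f x ∂ν ≠ ∞ := by
    have := h 0
    simp only [Nat.cast_zero, zero_add, one_mul] at this
    rw [hf, ← this]; exact hfin
  have : IsFiniteMeasure (μ.withDensity f) := isFiniteMeasure_withDensity hfin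
  have : IsFiniteMeasure (ν.withDensity f) := isFiniteMeasure_withDensity hfinν
  have hback : ∀ ρ : Measure ℝ, ρ (Iio 0) = 0 →
      ((ρ.withDensity f).map Real.toNNReal).map ((↑) : ℝ≥0 → ℝ) = ρ.withDensity f := by
    intro ρ hρ
    rw [Measure.map_map (by fun_prop) (by fun_prop)]
    have h0 : (ρ.withDensity f) (Iio 0) = 0 := withDensity_absolutelyContinuous _ _ hρ
    have : (((↑) : ℝ≥0 → ℝ) ∘ Real.toNNReal) =ᵐ[ρ.withDensity f] id := by
      have : ∀ᵐ x ∂(ρ.withDensity f), x ∉ Iio (0 : ℝ) := measure_eq_zero_iff_ae_notMem.1 h0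
      filter_upwards [this] with x hx
      simp only [mem_Iio, not_lt] at hx
      simp [hx]
    rw [Measure.map_congr this, Measure.map_id]
  have hint : ∀ ρ : Measure ℝ, ρ (Iio 0) = 0 → ∀ n : ℕ,
      ∫ x, Real.exp (-(n * (x : ℝ))) ∂((ρ.withDensity f).map Real.toNNReal)
        = (∫⁻ x, ENNReal.ofReal (Real.exp (-((n + 1) * x))) ∂ρ).toReal := by
    intro ρ hρ n
    have h1 : ∫ x, Real.exp (-(n * (x : ℝ))) ∂((ρ.withDensity f).map Real.toNNReal)
        = ∫ x, Real.exp (-(n * x)) ∂(ρ.withDensity f) := by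
      conv_rhs => rw [← hback ρ hρ]
      rw [integral_map (φ := ((↑) : ℝ≥0 → ℝ)) (by fun_prop) (by fun_prop)]
    rw [h1, integral_eq_lintegral_of_nonneg_ae (ae_of_all _ fun x => (Real.exp_pos _).le)
      (by fun_prop), lintegral_withDensity_eq_lintegral_mul _ hfm (by fun_prop)]
    congr 1
    refine lintegral_congr fun x => ?_
    simp only [hf, Pi.mul_apply]
    rw [← ENNReal.ofReal_mul (Real.exp_pos _).le, ← Real.exp_add]
    congr 2; ring
  have hmap : (μ.withDensity f).map Real.toNNReal = (ν.withDensity f).map Real.toNNReal := by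
    refine nnreal_measure_ext_of_integral_exp fun n => ?_
    rw [hint μ hμ, hint ν hν, h]
  have hd : μ.withDensity f = ν.withDensity f := by
    rw [← hback μ hμ, ← hback ν hν, hmap]
  rw [← withDensity_inv_same (μ := μ) hfm (ae_of_all _ hf0) (ae_of_all _ hft),
    ← withDensity_inv_same (μ := ν) hfm (ae_of_all _ hf0) (ae_of_all _ hft), hd]

/-! ### The Laplace exponent as a sum of powers -/

/-- `∫₀^∞ t^{-b} s e^{-st} dt = Γ(1-b) s^b`. -/
lemma lintegral_rpow_neg_mul_exp {b s : ℝ} (hb : b < 1) (hs : 0 < s) :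
    ∫⁻ t in Ioi (0 : ℝ), ENNReal.ofReal (t ^ (-b)) * ENNReal.ofReal (s * Real.exp (-(s * t)))
      = ENNReal.ofReal (Real.Gamma (1 - b) * s ^ b) := by
  have h1 := Real.integral_rpow_mul_exp_neg_mul_Ioi (a := 1 - b) (r := s) (by linarith) hs
  have hG : 0 < Real.Gamma (1 - b) := Real.Gamma_pos_of_pos (by linarith)
  have e1 : (1 - b - 1) = -b := by ring
  rw [e1] at h1
  have hint : IntegrableOn (fun t : ℝ => t ^ (-b) * Real.exp (-(s * t))) (Ioi 0) := by
    -- A non-integrable function would have Bochner integral 0, but the known value is positive.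
    by_contra hcon
    rw [integral_undef hcon] at h1
    have : 0 < (1 / s) ^ (1 - b) * Real.Gamma (1 - b) := by positivity
    linarith
  have h2 : Real.Gamma (1 - b) * s ^ b
      = ∫ t in Ioi (0 : ℝ), s * (t ^ (-b) * Real.exp (-(s * t))) := by
    rw [integral_const_mul, h1, one_div, Real.inv_rpow hs.le, ← Real.rpow_neg hs.le]
    have : s ^ b = s * s ^ (-(1 - b)) := by
      rw [neg_sub, Real.rpow_sub_one hs.ne']
      field_simp
    rw [this]; ring
  rw [h2, ofReal_integral_eq_lintegral_ofReal (hint.const_mul s)]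
  · refine setLIntegral_congr_fun measurableSet_Ioi fun t ht => ?_
    have ht : 0 < t := ht
    rw [← ENNReal.ofReal_mul (by positivity)]
    congr 1; ring
  · filter_upwards [ae_restrict_mem measurableSet_Ioi] with t ht
    have ht : 0 < t := ht
    simp only [Pi.zero_apply]; positivity

/-- The tails prescribed by the atomic mixing measure. -/
lemma lintegral_atomicMixingMeasure {n : ℕ} {β c : Fin n → ℝ}
    (hβ : ∀ j, β j ∈ Ioo (0 : ℝ) 1) (u : ℝ) :
    ∫⁻ b in Ioo (0 : ℝ) 1, ENNReal.ofReal (u ^ (-b)) ∂(atomicMixingMeasure β c)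
      = ∑ j, ENNReal.ofReal (c j ^ β j * (Real.Gamma (1 - β j))⁻¹)
          * ENNReal.ofReal (u ^ (-β j)) := by
  classical
  have hm : Measurable fun b : ℝ => ENNReal.ofReal (u ^ (-b)) := by fun_prop
  rw [← lintegral_indicator measurableSet_Ioo, atomicMixingMeasure, lintegral_finsetSum_measure]
  refine Finset.sum_congr rfl fun j _ => ?_
  rw [lintegral_smul_measure, lintegral_dirac' _ (hm.indicator measurableSet_Ioo),
    indicator_of_mem (hβ j), smul_eq_mul]

/-- The Laplace exponent of the mixture of stable subordinators. -/
theorem laplaceExponent_eq_sum {n : ℕ} {β c : Fin n → ℝ}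
    (hβ : ∀ j, β j ∈ Ioo (0 : ℝ) 1) (hc : ∀ j, 0 < c j) {φ : Measure ℝ}
    (hφ : ∀ u : ℝ, 0 < u →
      φ (Ioi u) = ∫⁻ b in Ioo (0 : ℝ) 1, ENNReal.ofReal (u ^ (-b)) ∂(atomicMixingMeasure β c))
    {s : ℝ} (hs : 0 < s) :
    laplaceExponent φ s = ∑ j, c j ^ β j * s ^ β j := by
  have hG : ∀ j, 0 < Real.Gamma (1 - β j) := fun j =>
    Real.Gamma_pos_of_pos (by linarith [(hβ j).2])
  have hpos : ∀ j, 0 < c j ^ β j := fun j => Real.rpow_pos_of_pos (hc j) _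
  -- Layer cake formula: 1 - e^{-sx} is the primitive of s e^{-st} vanishing at 0, so ψ(s) is an
  -- integral of the tails of φ.
  have hlay := lintegral_comp_eq_lintegral_meas_lt_mul (φ.restrict (Ioi 0)) (f := id)
    (g := fun t => s * Real.exp (-(s * t)))
    (by filter_upwards [ae_restrict_mem measurableSet_Ioi] with x hx using le_of_lt hx)
    aemeasurable_id
    (fun t _ => (Continuous.intervalIntegrable (by fun_prop) _ _))
    (ae_of_all _ fun t => by positivity)
  have hint : ∀ x : ℝ, ∫ t in (0 : ℝ)..x, s * Real.exp (-(s * t)) = 1 - Real.exp (-s * x) := by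
    intro x
    have hd : ∀ t ∈ uIcc 0 x, HasDerivAt (fun t => -Real.exp (-(s * t)))
        (s * Real.exp (-(s * t))) t := by
      intro t _
      have h : HasDerivAt (fun t => -(s * t)) (-s) t := by
        simpa using! ((hasDerivAt_id t).const_mul s).neg
      exact h.exp.neg.congr_deriv (by ring)
    rw [intervalIntegral.integral_eq_sub_of_hasDerivAt hd
      (Continuous.intervalIntegrable (by fun_prop) _ _)]
    simp; ring
  simp only [id, hint] at hlay
  have hR : ∫⁻ t in Ioi (0 : ℝ), (φ.restrict (Ioi 0)) {a | t < a}
        * ENNReal.ofReal (s * Real.exp (-(s * t)))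
      = ENNReal.ofReal (∑ j, c j ^ β j * s ^ β j) := by
    have : ∀ t ∈ Ioi (0 : ℝ), (φ.restrict (Ioi 0)) {a | t < a}
        * ENNReal.ofReal (s * Real.exp (-(s * t)))
        = ∑ j, ENNReal.ofReal (c j ^ β j * (Real.Gamma (1 - β j))⁻¹)
          * (ENNReal.ofReal (t ^ (-β j)) * ENNReal.ofReal (s * Real.exp (-(s * t)))) := by
      intro t ht
      have ht : 0 < t := ht
      have e : {a : ℝ | t < a} = Ioi t := rfl
      rw [e, Measure.restrict_apply measurableSet_Ioi,
        inter_eq_left.2 (Ioi_subset_Ioi ht.le), hφ t ht, lintegral_atomicMixingMeasure hβ,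
        Finset.sum_mul]
      simp_rw [mul_assoc]
    rw [setLIntegral_congr_fun measurableSet_Ioi this, lintegral_finsetSum _ (by fun_prop),
      ENNReal.ofReal_sum_of_nonneg (fun j _ => by have := hpos j; positivity)]
    refine Finset.sum_congr rfl fun j _ => ?_
    rw [lintegral_const_mul _ (by fun_prop), lintegral_rpow_neg_mul_exp (hβ j).2 hs,
      ← ENNReal.ofReal_mul (by have := hpos j; have := hG j; positivity)]
    congr 1
    have := (hG j).ne'
    field_simp
  rw [laplaceExponent, integral_eq_lintegral_of_nonneg_ae _ (by fun_prop), hlay, hR,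
    ENNReal.toReal_ofReal (Finset.sum_nonneg fun j _ => by have := hpos j; positivity)]
  filter_upwards [ae_restrict_mem measurableSet_Ioi] with x hx
  have hx : 0 < x := hx
  have : Real.exp (-s * x) ≤ 1 := Real.exp_le_one_iff.2 (by nlinarith)
  simpa using this

/-! ### Stieltjes representation of 1 / (λ + ψ) by contour integration -/

section Stieltjes

variable {ι : Type*} [Fintype ι]

/-- `λ + ψ(e^w)`, where `ψ(s) = ∑ⱼ aⱼ s ^ bⱼ`, as an entire function of `w`. -/
noncomputable def resolventDenom (lam : ℝ) (a b : ι → ℝ) (w : ℂ) : ℂ :=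
  lam + ∑ j, a j * Complex.exp (b j * w)

/-- The density of the Stieltjes measure of `1 / (λ + ψ)` in the logarithmic coordinate. -/
noncomputable def stieltjesDensity (lam : ℝ) (a b : ι → ℝ) (x : ℝ) : ℝ :=
  -((resolventDenom lam a b (x + Real.pi * Complex.I))⁻¹).im / Real.pi

variable {lam : ℝ} {a b : ι → ℝ}

lemma differentiable_resolventDenom : Differentiable ℂ (resolventDenom lam a b) := by
  unfold resolventDenom; fun_prop

lemma resolventDenom_ofReal (x : ℝ) :
    resolventDenom lam a b x = ((lam + ∑ j, a j * Real.exp (b j * x) : ℝ) : ℂ) := by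
  simp [resolventDenom]

lemma resolventDenom_conj (w : ℂ) :
    resolventDenom lam a b ((starRingEnd ℂ) w) = (starRingEnd ℂ) (resolventDenom lam a b w) := by
  simp [resolventDenom, ← Complex.exp_conj]

/-- In the closed strip `|Im w| ≤ π`, all terms of `λ + ψ(e^w)` lie in a common sector of opening
less than `π`, hence no cancellation takes place. -/
lemma exists_le_norm_resolventDenom [Nonempty ι] (hlam : 0 < lam) (ha : ∀ j, 0 < a j)
    (hb : ∀ j, b j ∈ Ioo (0 : ℝ) 1) :
    ∃ κ : ℝ, 0 < κ ∧ ∀ w : ℂ, |w.im| ≤ Real.pi →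
      κ * (lam + ∑ j, a j * Real.exp (b j * w.re)) ≤ ‖resolventDenom lam a b w‖ := by
  obtain ⟨i, hi⟩ := Finite.exists_max b
  have hi0 := (hb i).1
  have hi1 := (hb i).2
  have hπ := Real.pi_pos
  -- With b i the largest exponent, rotating by e^{-i (b i / 2) Im w} centres the sector: the
  -- arguments become -(b i / 2) Im w for λ and (b j - b i / 2) Im w for the other terms, all at
  -- most b i π / 2 < π / 2 in modulus.
  refine ⟨Real.cos (b i * Real.pi / 2), Real.cos_pos_of_mem_Ioo ⟨by nlinarith, by nlinarith⟩, ?_⟩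
  intro w hw
  have hcos : ∀ r : ℝ, |r| ≤ b i / 2 → Real.cos (b i * Real.pi / 2) ≤ Real.cos (r * w.im) := by
    intro r hr
    rw [← Real.cos_abs (r * w.im), abs_mul]
    refine Real.cos_le_cos_of_nonneg_of_le_pi (by positivity) (by nlinarith) ?_
    calc |r| * |w.im| ≤ b i / 2 * Real.pi := by gcongr
      _ = _ := by ring
  set e : ℂ := Complex.exp (((-(b i / 2) * w.im : ℝ) : ℂ) * Complex.I) with he
  have hnorm : ‖e‖ = 1 := Complex.norm_exp_ofReal_mul_I _
  have hre : (e * resolventDenom lam a b w).re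
      = lam * Real.cos (-(b i / 2) * w.im)
        + ∑ j, a j * Real.exp (b j * w.re) * Real.cos ((b j - b i / 2) * w.im) := by
    have hterm : ∀ j, e * (a j * Complex.exp (b j * w))
        = ((a j : ℝ) : ℂ) * Complex.exp
          (((b j * w.re : ℝ) : ℂ) + (((b j - b i / 2) * w.im : ℝ) : ℂ) * Complex.I) := by
      intro j
      rw [he, mul_left_comm, ← Complex.exp_add]
      congr 2
      push_cast
      linear_combination (-(b j : ℂ)) * Complex.re_add_im w
    rw [resolventDenom, mul_add, Finset.mul_sum, Complex.add_re, Complex.re_sum]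
    congr 1
    · rw [he, mul_comm, Complex.re_ofReal_mul, Complex.exp_ofReal_mul_I_re]
    · refine Finset.sum_congr rfl fun j _ => ?_
      rw [hterm, Complex.re_ofReal_mul, Complex.exp_add, ← Complex.ofReal_exp,
        Complex.re_ofReal_mul, Complex.exp_ofReal_mul_I_re, mul_assoc]
  calc Real.cos (b i * Real.pi / 2) * (lam + ∑ j, a j * Real.exp (b j * w.re))
      ≤ (e * resolventDenom lam a b w).re := by
        rw [hre, mul_add, Finset.mul_sum, mul_comm _ lam]
        refine add_le_add (mul_le_mul_of_nonneg_left (hcos _ ?_) hlam.le)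
          (Finset.sum_le_sum fun j _ => ?_)
        · rw [abs_neg, abs_of_pos (by positivity)]
        · rw [mul_comm]
          refine mul_le_mul_of_nonneg_left (hcos _ ?_) (mul_nonneg (ha j).le (Real.exp_pos _).le)
          rw [abs_le]
          constructor <;> linarith [(hb j).1, hi j]
    _ ≤ ‖e * resolventDenom lam a b w‖ := Complex.re_le_norm _
    _ = ‖resolventDenom lam a b w‖ := by rw [norm_mul, hnorm, one_mul]

lemma resolventDenom_ne_zero [Nonempty ι] (hlam : 0 < lam) (ha : ∀ j, 0 < a j)
    (hb : ∀ j, b j ∈ Ioo (0 : ℝ) 1) {w : ℂ} (hw : |w.im| ≤ Real.pi) :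
    resolventDenom lam a b w ≠ 0 := by
  obtain ⟨κ, hκ, h⟩ := exists_le_norm_resolventDenom hlam ha hb
  have hpos : 0 < lam + ∑ j, a j * Real.exp (b j * w.re) :=
    add_pos_of_pos_of_nonneg hlam
      (Finset.sum_nonneg fun j _ => mul_nonneg (ha j).le (Real.exp_pos _).le)
  exact norm_pos_iff.1 ((mul_pos hκ hpos).trans_le (h w hw))

/-- On the upper edge each term has imaginary part a_j e^{b_j x} sin(b_j π) ≥ 0, and inversion
reverses the sign. -/
lemma stieltjesDensity_nonneg (ha : ∀ j, 0 < a j) (hb : ∀ j, b j ∈ Ioo (0 : ℝ) 1) (x : ℝ) :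
    0 ≤ stieltjesDensity lam a b x := by
  have him : 0 ≤ (resolventDenom lam a b (x + Real.pi * Complex.I)).im := by
    rw [resolventDenom, Complex.add_im, Complex.im_sum, Complex.ofReal_im, zero_add]
    refine Finset.sum_nonneg fun j _ => ?_
    have : (b j : ℂ) * (x + Real.pi * Complex.I)
        = ((b j * x : ℝ) : ℂ) + ((b j * Real.pi : ℝ) : ℂ) * Complex.I := by push_cast; ring
    rw [this, Complex.im_ofReal_mul, Complex.exp_add, ← Complex.ofReal_exp, Complex.im_ofReal_mul,
      Complex.exp_ofReal_mul_I_im]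
    have hs : 0 ≤ Real.sin (b j * Real.pi) := Real.sin_nonneg_of_nonneg_of_le_pi
      (mul_nonneg (hb j).1.le Real.pi_pos.le) (by nlinarith [Real.pi_pos, (hb j).2])
    exact mul_nonneg (ha j).le (mul_nonneg (Real.exp_pos _).le hs)
  rw [stieltjesDensity, Complex.inv_im, neg_div (Complex.normSq _), neg_neg]
  exact div_nonneg (div_nonneg him (Complex.normSq_nonneg _)) Real.pi_pos.le

lemma continuous_stieltjesDensity [Nonempty ι] (hlam : 0 < lam) (ha : ∀ j, 0 < a j)
    (hb : ∀ j, b j ∈ Ioo (0 : ℝ) 1) : Continuous (stieltjesDensity lam a b) := by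
  unfold stieltjesDensity
  have h1 : Continuous fun x : ℝ => resolventDenom lam a b (x + Real.pi * Complex.I) :=
    differentiable_resolventDenom.continuous.comp (by fun_prop)
  have h2 := h1.inv₀ fun x => resolventDenom_ne_zero hlam ha hb (by simp [abs_of_pos Real.pi_pos])
  exact ((Complex.continuous_im.comp h2).neg).div_const _

/-- The difference quotient of `1 / (λ + ψ)` between `e^w` and `e^σ`, times `e^w`. -/
noncomputable def stieltjesKernel (lam : ℝ) (a b : ι → ℝ) (σ : ℝ) (w : ℂ) : ℂ :=
  Complex.exp w * (dslope (fun w => (resolventDenom lam a b w)⁻¹) σ w / dslope Complex.exp σ w)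

lemma stieltjesKernel_of_ne {σ : ℝ} {w : ℂ} (hw : w ≠ σ) :
    stieltjesKernel lam a b σ w = Complex.exp w *
      (((resolventDenom lam a b w)⁻¹ - (resolventDenom lam a b σ)⁻¹)
        / (Complex.exp w - Complex.exp σ)) := by
  rw [stieltjesKernel, dslope_of_ne _ hw, dslope_of_ne _ hw, slope_def_field, slope_def_field,
    div_div_div_cancel_right₀ (sub_ne_zero.2 hw)]

/-- Two points with the same exponential differ by a multiple of 2πi, while the strip only reaches
distance π from the real point σ. -/
lemma dslope_exp_ne_zero {σ : ℝ} {w : ℂ} (hw : |w.im| ≤ Real.pi) :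
    dslope Complex.exp σ w ≠ 0 := by
  by_cases h : w = σ
  · rw [h, dslope_same, Complex.deriv_exp]
    exact Complex.exp_ne_zero _
  · rw [dslope_of_ne _ h, slope_def_field]
    refine div_ne_zero (fun h0 => h ?_) (sub_ne_zero.2 h)
    rw [sub_eq_zero, Complex.exp_eq_exp_iff_exists_int] at h0
    obtain ⟨k, hk⟩ := h0
    have him : w.im = k * (2 * Real.pi) := by
      have := congrArg Complex.im hk
      simpa using this
    have hk0 : k = 0 := by
      by_contra hk0
      have h1 : (1 : ℝ) ≤ |(k : ℝ)| := by exact_mod_cast Int.one_le_abs hk0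
      rw [him, abs_mul, abs_of_pos (by positivity : (0 : ℝ) < 2 * Real.pi)] at hw
      nlinarith [Real.pi_pos]
    simpa [hk0] using hk

/-- Subtracting the value at σ makes the pole of 1 / (e^w - e^σ) removable, so Cauchy's theorem
applies with no residue; `dslope` supplies the value at σ. -/
lemma differentiableOn_stieltjesKernel [Nonempty ι] (hlam : 0 < lam) (ha : ∀ j, 0 < a j)
    (hb : ∀ j, b j ∈ Ioo (0 : ℝ) 1) (σ : ℝ) :
    DifferentiableOn ℂ (stieltjesKernel lam a b σ) {w | |w.im| ≤ Real.pi} := by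
  have hopen : IsOpen {w : ℂ | resolventDenom lam a b w ≠ 0} :=
    isOpen_ne_fun differentiable_resolventDenom.continuous continuous_const
  have h1 : DifferentiableOn ℂ (dslope (fun w => (resolventDenom lam a b w)⁻¹) σ)
      {w : ℂ | resolventDenom lam a b w ≠ 0} := by
    rw [Complex.differentiableOn_dslope (hopen.mem_nhds
      (resolventDenom_ne_zero hlam ha hb (by simp [Real.pi_pos.le])))]
    exact fun w hw =>
      (differentiable_resolventDenom.differentiableAt.inv hw).differentiableWithinAt
  have h2 : DifferentiableOn ℂ (dslope Complex.exp σ) univ := by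
    rw [Complex.differentiableOn_dslope Filter.univ_mem]
    exact Complex.differentiable_exp.differentiableOn
  exact Complex.differentiable_exp.differentiableOn.mul
    ((h1.mono fun w hw => resolventDenom_ne_zero hlam ha hb hw).div (h2.mono (subset_univ _))
      fun w hw => dslope_exp_ne_zero hw)

/-- On both edges e^w = -e^x, so the constant subtracted at σ cancels. What remains is the jump of 1
/ (λ + ψ) across the cut, a difference of conjugates. -/
lemma stieltjesKernel_sub (σ x : ℝ) :
    stieltjesKernel lam a b σ (x + (-Real.pi : ℝ) * Complex.I)
      - stieltjesKernel lam a b σ (x + Real.pi * Complex.I)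
      = ((Real.exp x / (Real.exp x + Real.exp σ) * stieltjesDensity lam a b x : ℝ) : ℂ)
        * (2 * Real.pi * Complex.I) := by
  have hne : ∀ y : ℝ, y ≠ 0 → (x + y * Complex.I : ℂ) ≠ σ := by
    intro y hy h
    have := congrArg Complex.im h
    simp at this
    exact hy this
  have hπ := Real.pi_pos.ne'
  rw [stieltjesKernel_of_ne (hne _ (neg_ne_zero.2 hπ)), stieltjesKernel_of_ne (hne _ hπ)]
  have e1 : Complex.exp (x + Real.pi * Complex.I) = -(Real.exp x : ℂ) := by
    rw [Complex.exp_add, Complex.exp_pi_mul_I]; simp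
  have hc : (x + (-Real.pi : ℝ) * Complex.I : ℂ)
      = (starRingEnd ℂ) (x + Real.pi * Complex.I) := by simp
  have e2 : Complex.exp (x + (-Real.pi : ℝ) * Complex.I) = -(Real.exp x : ℂ) := by
    rw [hc, Complex.exp_conj, e1, map_neg, Complex.conj_ofReal]
  rw [e2, e1, hc, resolventDenom_conj, ← Complex.ofReal_exp σ]
  set D := (resolventDenom lam a b (x + Real.pi * Complex.I))⁻¹ with hD
  have hDc : ((starRingEnd ℂ) (resolventDenom lam a b (x + Real.pi * Complex.I)))⁻¹
      = D - (2 * D.im : ℝ) * Complex.I := by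
    rw [← map_inv₀, ← hD]
    have := Complex.sub_conj D
    rw [← this]; ring
  rw [hDc, stieltjesDensity, ← hD]
  have hp : (Real.exp x : ℂ) + Real.exp σ ≠ 0 := by
    exact_mod_cast (add_pos (Real.exp_pos x) (Real.exp_pos σ)).ne'
  have hp' : -(Real.exp x : ℂ) - Real.exp σ ≠ 0 := by
    rw [← neg_add']; exact neg_ne_zero.2 hp
  have hπ' : (Real.pi : ℂ) ≠ 0 := by exact_mod_cast hπ
  simp only [Complex.ofReal_mul, Complex.ofReal_div, Complex.ofReal_add, Complex.ofReal_neg,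
    Complex.ofReal_ofNat]
  field_simp
  ring

lemma continuous_stieltjesKernel_vertical [Nonempty ι] (hlam : 0 < lam) (ha : ∀ j, 0 < a j)
    (hb : ∀ j, b j ∈ Ioo (0 : ℝ) 1) (σ R : ℝ) :
    ContinuousOn (fun y : ℝ => stieltjesKernel lam a b σ (R + y * Complex.I))
      (uIcc (-Real.pi) Real.pi) := by
  refine (differentiableOn_stieltjesKernel hlam ha hb σ).continuousOn.comp (by fun_prop) ?_
  intro y hy
  rw [uIcc_of_le (by linarith [Real.pi_pos])] at hy
  simpa using abs_le.2 hy

/-- Integrals over vertical segments converge if the integrand does so uniformly. -/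
lemma tendsto_integral_of_uniform_bound {f : ℝ → ℝ → ℂ} {c : ℂ} {ε : ℝ → ℝ}
    (hf : ∀ R, ContinuousOn (f R) (uIcc (-Real.pi) Real.pi))
    (hε : Filter.Tendsto ε Filter.atTop (nhds 0))
    (h : ∀ᶠ R in Filter.atTop, ∀ y, |y| ≤ Real.pi → ‖f R y - c‖ ≤ ε R) :
    Filter.Tendsto (fun R => ∫ y in (-Real.pi)..Real.pi, f R y) Filter.atTop
      (nhds (c * (2 * Real.pi))) := by
  have hπ := Real.pi_pos
  rw [tendsto_iff_norm_sub_tendsto_zero]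
  refine squeeze_zero' (.of_forall fun _ => norm_nonneg _) ?_
    (by simpa using hε.mul_const (2 * Real.pi))
  filter_upwards [h] with R hR
  have h1 : (∫ y in (-Real.pi)..Real.pi, f R y) - c * (2 * Real.pi)
      = ∫ y in (-Real.pi)..Real.pi, (f R y - c) := by
    rw [intervalIntegral.integral_sub (hf R).intervalIntegrable (by simp)]
    simp only [intervalIntegral.integral_const, sub_neg_eq_add, Complex.real_smul]
    push_cast; ring
  rw [h1]
  have h2 := intervalIntegral.norm_integral_le_of_norm_le_const (a := -Real.pi) (b := Real.pi)
    (f := fun y => f R y - c) (C := ε R) (fun y hy => ?_)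
  · rwa [sub_neg_eq_add, ← two_mul, abs_of_pos (by positivity : 0 < 2 * Real.pi)] at h2
  · rw [uIoc_of_le (by linarith)] at hy
    exact hR y (abs_le.2 ⟨hy.1.le, hy.2⟩)

/-- In the lower bound for the denominator, keeping only λ gives boundedness, and keeping only one
exponential gives decay to the right with δ = b i. -/
lemma norm_inv_resolventDenom_le [Nonempty ι] (hlam : 0 < lam) (ha : ∀ j, 0 < a j)
    (hb : ∀ j, b j ∈ Ioo (0 : ℝ) 1) :
    ∃ C : ℝ, ∃ δ : ℝ, 0 < C ∧ 0 < δ ∧ ∀ w : ℂ, |w.im| ≤ Real.pi →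
      ‖(resolventDenom lam a b w)⁻¹‖ ≤ C ∧
      ‖(resolventDenom lam a b w)⁻¹‖ ≤ C * Real.exp (-(δ * w.re)) := by
  obtain ⟨κ, hκ, h⟩ := exists_le_norm_resolventDenom hlam ha hb
  obtain ⟨i⟩ := ‹Nonempty ι›
  have hai := ha i
  refine ⟨max (κ * lam)⁻¹ (κ * a i)⁻¹, b i, lt_max_of_lt_left (by positivity), (hb i).1, ?_⟩
  intro w hw
  have hterm : ∀ j, 0 ≤ a j * Real.exp (b j * w.re) := fun j =>
    mul_nonneg (ha j).le (Real.exp_pos _).le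
  have hsum : a i * Real.exp (b i * w.re) ≤ ∑ j, a j * Real.exp (b j * w.re) :=
    Finset.single_le_sum (fun j _ => hterm j) (Finset.mem_univ i)
  have hw' := h w hw
  rw [norm_inv]
  constructor
  · refine le_trans (inv_anti₀ (by positivity) (le_trans ?_ hw')) (le_max_left _ _)
    gcongr
    linarith [hterm i]
  · rw [Real.exp_neg]
    calc ‖resolventDenom lam a b w‖⁻¹ ≤ (κ * (a i * Real.exp (b i * w.re)))⁻¹ := by
          refine inv_anti₀ (by positivity) (le_trans ?_ hw')
          gcongr
          linarith
      _ = (κ * a i)⁻¹ * (Real.exp (b i * w.re))⁻¹ := by rw [← mul_assoc, mul_inv]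
      _ ≤ _ := by gcongr; exact le_max_right _ _

lemma two_mul_exp_le_exp {x y : ℝ} (h : x + 1 ≤ y) : 2 * Real.exp x ≤ Real.exp y := by
  calc 2 * Real.exp x ≤ Real.exp 1 * Real.exp x := by
        gcongr
        linarith [Real.add_one_le_exp (1 : ℝ)]
    _ = Real.exp (x + 1) := by rw [Real.exp_add, mul_comm]
    _ ≤ _ := Real.exp_le_exp.2 h

lemma tendsto_exp_neg_mul_atTop {δ : ℝ} (hδ : 0 < δ) :
    Filter.Tendsto (fun R : ℝ => Real.exp (-(δ * R))) Filter.atTop (nhds 0) :=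
  Real.tendsto_exp_neg_atTop_nhds_zero.comp (Filter.tendsto_id.const_mul_atTop hδ)

/-- To the right 1 / (λ + ψ(e^w)) → 0 and e^w / (e^w - e^σ) → 1, uniformly in the strip, so only the
constant subtracted at σ survives. This is where the value of the transform comes from. -/
lemma tendsto_stieltjesKernel_atTop [Nonempty ι] (hlam : 0 < lam) (ha : ∀ j, 0 < a j)
    (hb : ∀ j, b j ∈ Ioo (0 : ℝ) 1) (σ : ℝ) :
    Filter.Tendsto (fun R : ℝ => ∫ y in (-Real.pi)..Real.pi,
      stieltjesKernel lam a b σ (R + y * Complex.I)) Filter.atTop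
      (nhds (-(resolventDenom lam a b σ)⁻¹ * (2 * Real.pi))) := by
  obtain ⟨C, δ, hC, hδ, hbd⟩ := norm_inv_resolventDenom_le hlam ha hb
  refine tendsto_integral_of_uniform_bound
    (ε := fun R => 2 * (C * Real.exp (-(δ * R)) + Real.exp σ * C * Real.exp (-(1 * R))))
    (continuous_stieltjesKernel_vertical hlam ha hb σ) ?_ ?_
  · simpa using (((tendsto_exp_neg_mul_atTop hδ).const_mul C).add
      ((tendsto_exp_neg_mul_atTop one_pos).const_mul (Real.exp σ * C))).const_mul 2
  filter_upwards [Filter.eventually_ge_atTop (σ + 1)] with R hR y hy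
  set w : ℂ := R + y * Complex.I with hw
  have hwre : w.re = R := by simp [hw]
  have hwim : w.im = y := by simp [hw]
  have hne : w ≠ σ := fun h => by
    have := congrArg Complex.re h
    rw [hwre, Complex.ofReal_re] at this
    linarith
  have h2 := two_mul_exp_le_exp hR
  have hnw : ‖Complex.exp w‖ = Real.exp R := by rw [Complex.norm_exp, hwre]
  have hnσ : ‖Complex.exp σ‖ = Real.exp σ := by rw [Complex.norm_exp, Complex.ofReal_re]
  have hdist : Real.exp R / 2 ≤ ‖Complex.exp w - Complex.exp σ‖ := by
    have := norm_sub_norm_le (Complex.exp w) (Complex.exp σ)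
    rw [hnw, hnσ] at this
    linarith
  have hpos : 0 < ‖Complex.exp w - Complex.exp σ‖ := lt_of_lt_of_le (by positivity) hdist
  have hform : stieltjesKernel lam a b σ w - -(resolventDenom lam a b σ)⁻¹
      = (Complex.exp w * (resolventDenom lam a b w)⁻¹
        - Complex.exp σ * (resolventDenom lam a b σ)⁻¹) / (Complex.exp w - Complex.exp σ) := by
    rw [stieltjesKernel_of_ne hne, eq_div_iff (norm_pos_iff.1 hpos), sub_mul, mul_assoc,
      div_mul_cancel₀ _ (norm_pos_iff.1 hpos)]
    ring
  have hGw := (hbd w (by rwa [hwim])).2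
  have hGσ := (hbd σ (by simp [Real.pi_pos.le])).1
  rw [hwre] at hGw
  rw [hform, norm_div, div_le_iff₀ hpos]
  calc ‖Complex.exp w * (resolventDenom lam a b w)⁻¹
        - Complex.exp σ * (resolventDenom lam a b σ)⁻¹‖
      ≤ Real.exp R * (C * Real.exp (-(δ * R))) + Real.exp σ * C := by
        refine (norm_sub_le _ _).trans ?_
        rw [norm_mul, norm_mul, hnw, hnσ]
        gcongr
    _ = 2 * (C * Real.exp (-(δ * R)) + Real.exp σ * C * Real.exp (-(1 * R)))
        * (Real.exp R / 2) := by
        have : Real.exp (-(1 * R)) * Real.exp R = 1 := by rw [← Real.exp_add]; simp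
        linear_combination (-(Real.exp σ * C)) * this
    _ ≤ _ := by gcongr

/-- To the left the factor e^w tends to 0 while the difference quotient stays bounded. -/
lemma tendsto_stieltjesKernel_atBot [Nonempty ι] (hlam : 0 < lam) (ha : ∀ j, 0 < a j)
    (hb : ∀ j, b j ∈ Ioo (0 : ℝ) 1) (σ : ℝ) :
    Filter.Tendsto (fun R : ℝ => ∫ y in (-Real.pi)..Real.pi,
      stieltjesKernel lam a b σ ((-R : ℝ) + y * Complex.I)) Filter.atTop (nhds 0) := by
  obtain ⟨C, δ, hC, hδ, hbd⟩ := norm_inv_resolventDenom_le hlam ha hb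
  have key := tendsto_integral_of_uniform_bound (c := 0)
    (f := fun R y => stieltjesKernel lam a b σ ((-R : ℝ) + y * Complex.I))
    (ε := fun R => 2 * (Real.exp σ)⁻¹ * (C + C) * Real.exp (-(1 * R)))
    (fun R => continuous_stieltjesKernel_vertical hlam ha hb σ (-R)) ?_ ?_
  · simpa using key
  · simpa using (tendsto_exp_neg_mul_atTop one_pos).const_mul (2 * (Real.exp σ)⁻¹ * (C + C))
  filter_upwards [Filter.eventually_ge_atTop (1 - σ)] with R hR y hy
  set w : ℂ := (-R : ℝ) + y * Complex.I with hw
  have hwre : w.re = -R := by simp [hw]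
  have hwim : w.im = y := by simp [hw]
  have hne : w ≠ σ := fun h => by
    have := congrArg Complex.re h
    rw [hwre, Complex.ofReal_re] at this
    linarith
  have h2 := two_mul_exp_le_exp (by linarith : -R + 1 ≤ σ)
  have hnw : ‖Complex.exp w‖ = Real.exp (-R) := by rw [Complex.norm_exp, hwre]
  have hnσ : ‖Complex.exp σ‖ = Real.exp σ := by rw [Complex.norm_exp, Complex.ofReal_re]
  have hdist : Real.exp σ / 2 ≤ ‖Complex.exp w - Complex.exp σ‖ := by
    have := norm_sub_norm_le (Complex.exp σ) (Complex.exp w)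
    rw [hnw, hnσ, norm_sub_rev] at this
    linarith
  have hpos : 0 < ‖Complex.exp w - Complex.exp σ‖ := lt_of_lt_of_le (by positivity) hdist
  have hGw := (hbd w (by rwa [hwim])).1
  have hGσ := (hbd σ (by simp [Real.pi_pos.le])).1
  rw [sub_zero, stieltjesKernel_of_ne hne, ← mul_div_assoc, norm_div, div_le_iff₀ hpos, norm_mul,
    hnw]
  calc Real.exp (-R) * ‖(resolventDenom lam a b w)⁻¹ - (resolventDenom lam a b σ)⁻¹‖
      ≤ Real.exp (-R) * (C + C) := by
        gcongr
        exact (norm_sub_le _ _).trans (add_le_add hGw hGσ)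
    _ = 2 * (Real.exp σ)⁻¹ * (C + C) * Real.exp (-(1 * R)) * (Real.exp σ / 2) := by
        rw [one_mul]
        field_simp
    _ ≤ _ := by gcongr

lemma integral_stieltjesDensity_rect [Nonempty ι] (hlam : 0 < lam) (ha : ∀ j, 0 < a j)
    (hb : ∀ j, b j ∈ Ioo (0 : ℝ) 1) (σ R : ℝ) :
    ((∫ x in (-R)..R, Real.exp x / (Real.exp x + Real.exp σ) * stieltjesDensity lam a b x : ℝ) : ℂ)
      * (2 * Real.pi)
      = (∫ y in (-Real.pi)..Real.pi, stieltjesKernel lam a b σ ((-R : ℝ) + y * Complex.I))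
        - ∫ y in (-Real.pi)..Real.pi, stieltjesKernel lam a b σ (R + y * Complex.I) := by
  have hd := differentiableOn_stieltjesKernel hlam ha hb σ
  have hπ := Real.pi_pos
  have hrect := Complex.integral_boundary_rect_eq_zero_of_differentiableOn
    (stieltjesKernel lam a b σ) (⟨-R, -Real.pi⟩ : ℂ) (⟨R, Real.pi⟩ : ℂ) (hd.mono ?_)
  · simp only [smul_eq_mul] at hrect
    have hcont : ∀ y : ℝ, |y| ≤ Real.pi →
        Continuous fun x : ℝ => stieltjesKernel lam a b σ (x + y * Complex.I) := fun y hy =>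
      hd.continuousOn.comp_continuous (by fun_prop) fun x => by simpa using hy
    rw [← intervalIntegral.integral_sub
      ((hcont _ (by simp [abs_of_pos hπ])).intervalIntegrable _ _)
      ((hcont _ (by simp [abs_of_pos hπ])).intervalIntegrable _ _)] at hrect
    simp only [stieltjesKernel_sub] at hrect
    rw [intervalIntegral.integral_mul_const, intervalIntegral.integral_ofReal] at hrect
    apply mul_left_cancel₀ Complex.I_ne_zero
    linear_combination hrect
  · rintro w ⟨-, hw⟩
    simp only [mem_preimage, uIcc_of_le (by linarith : -Real.pi ≤ Real.pi)] at hw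
    exact abs_le.2 hw

/-- The Stieltjes representation of `1 / (λ + ψ)`. -/
theorem exists_stieltjes_measure [Nonempty ι] (hlam : 0 < lam) (ha : ∀ j, 0 < a j)
    (hb : ∀ j, b j ∈ Ioo (0 : ℝ) 1) :
    ∃ ν : Measure ℝ, SFinite ν ∧ ∀ s : ℝ, 0 < s →
      ∫⁻ x, ENNReal.ofReal (s + Real.exp x)⁻¹ ∂ν
        = ENNReal.ofReal (lam + ∑ j, a j * s ^ b j)⁻¹ := by
  have hc := continuous_stieltjesDensity hlam ha hb
  have h0 := stieltjesDensity_nonneg (lam := lam) ha hb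
  -- The factor e^x is the Jacobian of u = e^x.
  refine ⟨volume.withDensity
    (fun x => ENNReal.ofReal (Real.exp x * stieltjesDensity lam a b x)), inferInstance, ?_⟩
  intro s hs
  set σ := Real.log s with hσ
  have hexp : Real.exp σ = s := Real.exp_log hs
  set f : ℝ → ℝ := fun x => Real.exp x / (Real.exp x + Real.exp σ) * stieltjesDensity lam a b x
    with hf
  have hfc : Continuous f := by
    refine Continuous.mul (Continuous.div (by fun_prop) (by fun_prop) fun x => ?_) hc
    positivity
  have hf0 : ∀ x, 0 ≤ f x := fun x => mul_nonneg (by positivity) (h0 x)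
  have hlim : Filter.Tendsto (fun R : ℝ => ∫ x in (-R)..R, f x) Filter.atTop
      (nhds (lam + ∑ j, a j * s ^ b j)⁻¹) := by
    have h1 := (tendsto_stieltjesKernel_atBot hlam ha hb σ).sub
      (tendsto_stieltjesKernel_atTop hlam ha hb σ)
    simp only [← integral_stieltjesDensity_rect hlam ha hb] at h1
    have hπ : (2 * Real.pi : ℂ) ≠ 0 := by exact_mod_cast (by positivity : 2 * Real.pi ≠ 0)
    have h2 := h1.div_const (2 * Real.pi : ℂ)
    simp only [mul_div_cancel_right₀ _ hπ] at h2
    have h3 := (Complex.continuous_re.tendsto _).comp h2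
    simp only [Function.comp_def, Complex.ofReal_re] at h3
    convert h3 using 2
    rw [zero_sub, neg_mul, neg_neg, mul_div_cancel_right₀ _ hπ, resolventDenom_ofReal,
      ← Complex.ofReal_inv, Complex.ofReal_re]
    congr 3
    ext j
    rw [Real.rpow_def_of_pos hs, mul_comm (b j)]
  -- As f ≥ 0, convergence over symmetric intervals already gives integrability.
  have hint : Integrable f := by
    refine integrable_of_intervalIntegral_norm_tendsto ((lam + ∑ j, a j * s ^ b j)⁻¹) (l := Filter.atTop)
      (a := fun R : ℝ => -R) (b := fun R : ℝ => R)
      (fun R => (hfc.integrableOn_Icc).mono_set Ioc_subset_Icc_self)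
      Filter.tendsto_neg_atTop_atBot Filter.tendsto_id ?_
    simpa only [Real.norm_of_nonneg (hf0 _)] using hlim
  have hval : ∫ x, f x = (lam + ∑ j, a j * s ^ b j)⁻¹ :=
    tendsto_nhds_unique (intervalIntegral_tendsto_integral hint
      Filter.tendsto_neg_atTop_atBot Filter.tendsto_id) hlim
  rw [← hval, ofReal_integral_eq_lintegral_ofReal hint (ae_of_all _ hf0),
    lintegral_withDensity_eq_lintegral_mul _ (by fun_prop) (by fun_prop)]
  refine lintegral_congr fun x => ?_
  rw [Pi.mul_apply, ← ENNReal.ofReal_mul (mul_nonneg (Real.exp_pos _).le (h0 x)), hf, hexp]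
  congr 1
  simp only [div_eq_mul_inv, add_comm s]
  ring

end Stieltjes

/-! ### The independent exponential time -/

lemma lintegral_exp_neg_mul_Ioi {r : ℝ} (hr : 0 < r) (e : ℝ) :
    ∫⁻ t in Ioi e, ENNReal.ofReal (Real.exp (-(r * t)))
      = ENNReal.ofReal (Real.exp (-(r * e)) * r⁻¹) := by
  have h1 := integral_exp_mul_Ioi (a := -r) (by linarith) e
  have h2 := integrableOn_exp_mul_Ioi (a := -r) (by linarith) e
  simp only [neg_mul] at h1 h2
  rw [← ofReal_integral_eq_lintegral_ofReal h2 (ae_of_all _ fun _ => (Real.exp_pos _).le), h1]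
  congr 1
  rw [neg_div_neg_eq, div_eq_mul_inv]

/-- The law of an exponential clock of rate `lam`. -/
noncomputable def expClock (lam : ℝ) : Measure ℝ :=
  (volume.restrict (Ioi 0)).withDensity fun τ => ENNReal.ofReal (lam * Real.exp (-(lam * τ)))

instance (lam : ℝ) : SFinite (expClock lam) := by unfold expClock; infer_instance

instance (lam : ℝ) : NullSingletonClass (expClock lam) := by unfold expClock; infer_instance

lemma lintegral_expClock {lam ψ : ℝ} (hlam : 0 < lam) (hψ : 0 ≤ ψ) :
    ∫⁻ τ, ENNReal.ofReal (Real.exp (-(τ.toNNReal : ℝ) * ψ)) ∂(expClock lam)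
      = ENNReal.ofReal (lam * (lam + ψ)⁻¹) := by
  rw [expClock, lintegral_withDensity_eq_lintegral_mul _ (by fun_prop) (by fun_prop)]
  have : ∀ τ ∈ Ioi (0 : ℝ), ((fun τ => ENNReal.ofReal (lam * Real.exp (-(lam * τ))))
      * fun τ : ℝ => ENNReal.ofReal (Real.exp (-(τ.toNNReal : ℝ) * ψ))) τ
      = ENNReal.ofReal lam * ENNReal.ofReal (Real.exp (-((lam + ψ) * τ))) := by
    intro τ hτ
    have hτ : 0 < τ := hτ
    rw [Pi.mul_apply, Real.coe_toNNReal _ hτ.le, ENNReal.ofReal_mul hlam.le, mul_assoc,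
      ← ENNReal.ofReal_mul (Real.exp_pos _).le, ← Real.exp_add]
    congr 3; ring
  rw [setLIntegral_congr_fun measurableSet_Ioi this, lintegral_const_mul _ (by fun_prop),
    lintegral_exp_neg_mul_Ioi (by linarith), ← ENNReal.ofReal_mul hlam.le]
  simp

lemma expClock_Ioi {lam e : ℝ} (hlam : 0 < lam) (he : 0 ≤ e) :
    expClock lam (Ioi e) = ENNReal.ofReal (Real.exp (-(lam * e))) := by
  rw [expClock, withDensity_apply _ measurableSet_Ioi, Measure.restrict_restrict measurableSet_Ioi,
    inter_eq_left.2 (Ioi_subset_Ioi he)]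
  simp_rw [ENNReal.ofReal_mul hlam.le]
  rw [lintegral_const_mul _ (by fun_prop), lintegral_exp_neg_mul_Ioi hlam,
    ← ENNReal.ofReal_mul hlam.le]
  congr 1
  field_simp

/-- The clock has no atoms, so it does not matter whether the process exceeds the level at the
hitting time itself. -/
lemma expClock_of_subset {lam e : ℝ} (hlam : 0 < lam) (he : 0 ≤ e) {A : Set ℝ}
    (h1 : Ioi e ⊆ A) (h2 : A ⊆ Ici e) :
    expClock lam A = ENNReal.ofReal (Real.exp (-(lam * e))) := by
  rw [← expClock_Ioi hlam he]
  refine le_antisymm ?_ (measure_mono h1)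
  exact (measure_mono h2).trans_eq (measure_congr Ioi_ae_eq_Ici).symm

lemma isProbabilityMeasure_expClock {lam : ℝ} (hlam : 0 < lam) :
    IsProbabilityMeasure (expClock lam) := by
  have := lintegral_expClock hlam le_rfl
  simp only [mul_zero, Real.exp_zero, ENNReal.ofReal_one, lintegral_const, one_mul, add_zero,
    mul_inv_cancel₀ hlam.ne'] at this
  exact ⟨this⟩

lemma laplaceExponent_nonneg (φ : Measure ℝ) {s : ℝ} (hs : 0 ≤ s) : 0 ≤ laplaceExponent φ s := by
  refine setIntegral_nonneg measurableSet_Ioi fun x hx => ?_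
  have hx : 0 < x := hx
  have : Real.exp (-s * x) ≤ 1 := Real.exp_le_one_iff.2 (by nlinarith)
  linarith

/-! ### Regular paths and the law of W at the exponential time -/

/-- A process with right-continuous paths is jointly measurable. -/
lemma measurable_uncurry_of_rightContinuous {Ω : Type*} [MeasurableSpace Ω]
    {V : ℝ≥0 → Ω → ℝ} (hm : ∀ t, Measurable (V t))
    (hr : ∀ ω t, ContinuousWithinAt (fun u => V u ω) (Ici t) t) :
    Measurable fun p : ℝ≥0 × Ω => V p.1 p.2 := by
  -- k n τ is the floor of (n + 1) τ, so (k n τ + 1) / (n + 1) approaches τ from the right, where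
  -- the paths are continuous.
  obtain ⟨k, hkm, hk1, hk2⟩ : ∃ k : ℕ → ℝ≥0 → ℕ, (∀ n, Measurable (k n)) ∧
      (∀ (n : ℕ) (τ : ℝ≥0), ((n : ℝ≥0) + 1) * τ ≤ k n τ + 1) ∧
      ∀ (n : ℕ) (τ : ℝ≥0), (k n τ : ℝ≥0) ≤ ((n : ℝ≥0) + 1) * τ := by
    refine ⟨fun n τ => ⌊((n : ℝ) + 1) * (τ : ℝ)⌋₊, fun n => ?_, fun n τ => ?_, fun n τ => ?_⟩
    · have : Measurable fun τ : ℝ≥0 => ((n : ℝ) + 1) * (τ : ℝ) := by fun_prop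
      exact this.nat_floor
    · exact_mod_cast (Nat.lt_floor_add_one (((n : ℝ) + 1) * (τ : ℝ))).le
    · exact_mod_cast Nat.floor_le (a := ((n : ℝ) + 1) * (τ : ℝ)) (by positivity)
  let e : ℕ → ℕ → ℝ≥0 := fun n k => ((k : ℝ≥0) + 1) / ((n : ℝ≥0) + 1)
  have hd : ∀ n τ, τ ≤ e n (k n τ) := fun n τ => by
    rw [le_div_iff₀ (by positivity), mul_comm]
    exact hk1 n τ
  have hd' : ∀ n τ, e n (k n τ) ≤ τ + 1 / ((n : ℝ≥0) + 1) := fun n τ => by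
    have hn : (n : ℝ≥0) + 1 ≠ 0 := by positivity
    rw [div_le_iff₀ (by positivity), add_mul τ, one_div, inv_mul_cancel₀ hn, mul_comm τ]
    gcongr
    exact hk2 n τ
  have hlim : ∀ τ, Filter.Tendsto (fun n => e n (k n τ)) Filter.atTop (nhdsWithin τ (Ici τ)) := by
    intro τ
    refine tendsto_nhdsWithin_iff.2 ⟨?_, .of_forall fun n => hd n τ⟩
    refine tendsto_of_tendsto_of_tendsto_of_le_of_le tendsto_const_nhds ?_
      (fun n => hd n τ) (fun n => hd' n τ)
    simpa using (tendsto_const_nhds (x := τ)).add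
      (tendsto_one_div_add_atTop_nhds_zero_nat (𝕜 := ℝ≥0))
  refine measurable_of_tendsto_metrizable (f := fun n p => V (e n (k n p.1)) p.2) (fun n => ?_) ?_
  · have h1 : Measurable fun q : ℕ × Ω => V (e n q.1) q.2 :=
      measurable_from_prod_countable_right fun k => hm (e n k)
    have h2 : Measurable fun p : ℝ≥0 × Ω => (k n p.1, p.2) :=
      ((hkm n).comp measurable_fst).prodMk measurable_snd
    have h3 := h1.comp h2
    exact h3
  · rw [tendsto_pi_nhds]
    exact fun p => (hr p.2 p.1).tendsto.comp (hlim p.1)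

section

variable {Ω : Type*} [MeasurableSpace Ω] {P : Measure Ω} {W : ℝ≥0 → Ω → ℝ} {φ : Measure ℝ}

lemma IsSubordinator.lintegral_exp (hW : IsSubordinator P W φ) (t : ℝ≥0) {s : ℝ} (hs : 0 ≤ s) :
    ∫⁻ ω, ENNReal.ofReal (Real.exp (-(s * W t ω))) ∂P
      = ENNReal.ofReal (Real.exp (-(t : ℝ) * laplaceExponent φ s)) := by
  have h := hW.laplace t s hs
  simp only [neg_mul s] at h
  rw [← h, ofReal_integral_eq_lintegral_ofReal _ (ae_of_all _ fun _ => (Real.exp_pos _).le)]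
  by_contra hcon
  rw [integral_undef hcon] at h
  exact (Real.exp_pos _).ne h

/-- The expectation of inf_n e^{-W_n} is at most e^{-n ψ(1)} for every n, hence 0. Unbounded paths
make the set in the hitting time nonempty, so its infimum is not a default value. -/
lemma IsSubordinator.ae_exists_gt (hW : IsSubordinator P W φ) (hψ : 0 < laplaceExponent φ 1) :
    ∀ᵐ ω ∂P, ∀ K : ℝ, ∃ n : ℕ, K < W n ω := by
  have hm : ∀ n : ℕ, Measurable fun ω => ENNReal.ofReal (Real.exp (-(1 * W n ω))) := fun n => by
    have := hW.measurable n
    fun_prop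
  have hz : ∫⁻ ω, ⨅ n : ℕ, ENNReal.ofReal (Real.exp (-(1 * W n ω))) ∂P = 0 := by
    refine le_antisymm ?_ zero_le
    have hlim : Filter.Tendsto
        (fun n : ℕ => ENNReal.ofReal (Real.exp (-((n : ℝ≥0) : ℝ) * laplaceExponent φ 1)))
        Filter.atTop (nhds 0) := by
      rw [← ENNReal.ofReal_zero]
      refine ENNReal.tendsto_ofReal ?_
      have := (tendsto_exp_neg_mul_atTop hψ).comp tendsto_natCast_atTop_atTop
      refine this.congr fun n => ?_
      simp [mul_comm]
    refine ge_of_tendsto' hlim fun n => ?_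
    rw [← hW.lintegral_exp n zero_le_one]
    exact lintegral_mono fun ω => iInf_le _ n
  rw [lintegral_eq_zero_iff (.iInf hm)] at hz
  filter_upwards [hz] with ω hω K
  have : ⨅ n : ℕ, ENNReal.ofReal (Real.exp (-(1 * W n ω))) < ENNReal.ofReal (Real.exp (-K)) := by
    rw [hω]
    simpa using Real.exp_pos _
  obtain ⟨n, hn⟩ := iInf_lt_iff.1 this
  refine ⟨n, ?_⟩
  rw [ENNReal.ofReal_lt_ofReal_iff (Real.exp_pos _), Real.exp_lt_exp] at hn
  linarith

/-- A version of the subordinator all of whose paths are regular. -/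
lemma IsSubordinator.exists_regular_version (hW : IsSubordinator P W φ)
    (hψ : 0 < laplaceExponent φ 1) :
    ∃ V : ℝ≥0 → Ω → ℝ, (∀ t, Measurable (V t)) ∧ (∀ ω, V 0 ω = 0) ∧
      (∀ ω, Monotone fun t => V t ω) ∧
      (∀ ω t, ContinuousWithinAt (fun u => V u ω) (Ici t) t) ∧
      (∀ ω (K : ℝ), ∃ t, K < V t ω) ∧ ∀ᵐ ω ∂P, ∀ t, W t ω = V t ω := by
  classical
  obtain ⟨G, hG, hGm, hGP⟩ : ∃ G : Set Ω, (∀ ω ∈ G, W 0 ω = 0 ∧ (Monotone fun t => W t ω) ∧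
      (∀ t, ContinuousWithinAt (fun u => W u ω) (Ici t) t) ∧ ∀ K : ℝ, ∃ n : ℕ, K < W n ω) ∧
      MeasurableSet G ∧ ∀ᵐ ω ∂P, ω ∈ G := by
    have h := hW.zero.and (hW.monotone.and (hW.rightContinuous.and (hW.ae_exists_gt hψ)))
    obtain ⟨B, hB, hBm, hB0⟩ := exists_measurable_superset_of_null (ae_iff.1 h)
    refine ⟨Bᶜ, fun ω hω => ?_, hBm.compl, measure_eq_zero_iff_ae_notMem.1 hB0⟩
    by_contra hcon
    exact hω (hB hcon)
  -- On the exceptional null set the path is replaced by t ↦ t, which has all the required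
  -- properties.
  refine ⟨fun t ω => if ω ∈ G then W t ω else t,
    fun t => Measurable.ite hGm (hW.measurable t) measurable_const, fun ω => ?_, fun ω => ?_,
    fun ω => ?_, fun ω => ?_, ?_⟩
  · by_cases h : ω ∈ G
    · simp [h, (hG ω h).1]
    · simp [h]
  · by_cases h : ω ∈ G
    · simpa [h] using (hG ω h).2.1
    · simpa [h] using NNReal.coe_mono
  · by_cases h : ω ∈ G
    · simpa [h] using (hG ω h).2.2.1
    · simpa [h] using fun t => NNReal.continuous_coe.continuousWithinAt
  · by_cases h : ω ∈ G
    · intro K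
      obtain ⟨n, hn⟩ := (hG ω h).2.2.2 K
      exact ⟨n, by simpa [h] using hn⟩
    · intro K
      refine ⟨K.toNNReal + 1, ?_⟩
      simp only [h, if_false]
      push_cast
      linarith [Real.le_coe_toNNReal K]
  · filter_upwards [hGP] with ω hω t
    simp [hω]

/-- `1 - h(·, lam)` is the distribution function of the subordinator evaluated at an independent
exponential time, whose Laplace transform is `lam / (lam + ψ)`. -/
theorem IsSubordinator.exists_law_at_expClock [IsProbabilityMeasure P]
    (hW : IsSubordinator P W φ) (hψ : 0 < laplaceExponent φ 1) {lam : ℝ} (hlam : 0 < lam) :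
    ∃ M : Measure ℝ, IsProbabilityMeasure M ∧ M (Iio 0) = 0 ∧
      (∀ t, 0 ≤ t → hittingLaplace P W t lam = (M (Ioi t)).toReal) ∧
      ∀ s, 0 ≤ s → ∫⁻ x, ENNReal.ofReal (Real.exp (-(s * x))) ∂M
        = ENNReal.ofReal (lam * (lam + laplaceExponent φ s)⁻¹) := by
  obtain ⟨V, hVm, hV0, hVmono, hVr, hVtop, hVW⟩ := hW.exists_regular_version hψ
  have hprob := isProbabilityMeasure_expClock hlam
  have hX : Measurable fun p : ℝ × Ω => V p.1.toNNReal p.2 :=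
    (measurable_uncurry_of_rightContinuous hVm hVr).comp
      ((measurable_real_toNNReal.comp measurable_fst).prodMk measurable_snd)
  refine ⟨((expClock lam).prod P).map fun p : ℝ × Ω => V p.1.toNNReal p.2,
    Measure.isProbabilityMeasure_map hX.aemeasurable, ?_, ?_, ?_⟩
  · rw [Measure.map_apply hX measurableSet_Iio]
    convert measure_empty (μ := (expClock lam).prod P)
    ext p
    simp only [mem_preimage, mem_Iio, mem_empty_iff_false, iff_false, not_lt]
    rw [← hV0 p.2]
    exact hVmono p.2 zero_le
  · intro t ht
    -- By monotonicity the times at which the path exceeds t form a half line starting at E_t.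
    -- Negative times are excluded because V 0 = 0 ≤ t.
    have hset : ∀ ω, expClock lam {τ | t < V τ.toNNReal ω}
        = ENNReal.ofReal (Real.exp (-lam * hittingTimeProcess V t ω)) := by
      intro ω
      rw [neg_mul]
      refine expClock_of_subset hlam NNReal.zero_le_coe (fun τ hτ => ?_) (fun τ hτ => ?_)
      · have hτ : ((sInf {τ : ℝ≥0 | t < V τ ω} : ℝ≥0) : ℝ) < τ := hτ
        obtain ⟨r, hr, hrτ⟩ := exists_lt_of_csInf_lt (hVtop ω t) (Real.lt_toNNReal_iff_coe_lt.2 hτ)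
        exact lt_of_lt_of_le hr (hVmono ω hrτ.le)
      · have hτ : t < V τ.toNNReal ω := hτ
        have hle : sInf {τ : ℝ≥0 | t < V τ ω} ≤ τ.toNNReal := csInf_le (OrderBot.bddBelow _) hτ
        have hτ0 : 0 ≤ τ := by
          by_contra hneg
          rw [Real.toNNReal_of_nonpos (not_le.1 hneg).le, hV0] at hτ
          linarith
        exact (NNReal.coe_le_coe.2 hle).trans_eq (Real.coe_toNNReal _ hτ0)
    have hS : MeasurableSet {p : ℝ × Ω | t < V p.1.toNNReal p.2} :=
      measurableSet_lt measurable_const hX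
    have hmeas : Measurable fun ω => expClock lam {τ | t < V τ.toNNReal ω} :=
      measurable_measure_prodMk_right hS
    have hEm : Measurable fun ω => Real.exp (-lam * hittingTimeProcess V t ω) := by
      have := hmeas.ennreal_toReal
      simp only [hset] at this
      simpa only [ENNReal.toReal_ofReal (Real.exp_pos _).le] using this
    have hcongr : hittingLaplace P W t lam
        = ∫ ω, Real.exp (-lam * hittingTimeProcess V t ω) ∂P := by
      refine integral_congr_ae ?_
      filter_upwards [hVW] with ω hω
      simp only [hittingTimeProcess, hω]
    rw [hcongr, integral_eq_lintegral_of_nonneg_ae (ae_of_all _ fun _ => (Real.exp_pos _).le)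
      hEm.aestronglyMeasurable, Measure.map_apply hX measurableSet_Ioi,
      Measure.prod_apply_symm (hX measurableSet_Ioi)]
    congr 1
    exact lintegral_congr fun ω => (hset ω).symm
  · intro s hs
    have hXs : Measurable fun p : ℝ × Ω =>
        ENNReal.ofReal (Real.exp (-(s * V p.1.toNNReal p.2))) :=
      (hX.const_mul s).neg.exp.ennreal_ofReal
    rw [lintegral_map (by fun_prop) hX, lintegral_prod _ hXs.aemeasurable,
      ← lintegral_expClock hlam (laplaceExponent_nonneg φ hs)]
    refine lintegral_congr fun τ => ?_
    rw [← hW.lintegral_exp _ hs]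
    refine lintegral_congr_ae ?_
    filter_upwards [hVW] with ω hω
    rw [hω]

end

/-! ### The completely monotone density -/

section LaplaceDensity

variable {ν : Measure ℝ}

/-- The completely monotone function `t ↦ ∫ e^{-t e^x} ν(dx)`. -/
noncomputable def laplaceDensity (ν : Measure ℝ) (t : ℝ) : ℝ :=
  ∫ x, Real.exp (-(t * Real.exp x)) ∂ν

/-- This is 1 + y ≤ e^y with y = t e^x. It bounds the density by the Stieltjes transform at s = 1/t,
which gives both finiteness and the final estimate. -/
lemma lintegral_exp_neg_mul_exp_le {t : ℝ} (ht : 0 < t) :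
    ∫⁻ x, ENNReal.ofReal (Real.exp (-(t * Real.exp x))) ∂ν
      ≤ ENNReal.ofReal t⁻¹ * ∫⁻ x, ENNReal.ofReal (t⁻¹ + Real.exp x)⁻¹ ∂ν := by
  rw [← lintegral_const_mul _ (by fun_prop)]
  refine lintegral_mono fun x => ?_
  rw [← ENNReal.ofReal_mul (by positivity)]
  refine ENNReal.ofReal_le_ofReal ?_
  have h1 : t⁻¹ * (t⁻¹ + Real.exp x)⁻¹ = (t * Real.exp x + 1)⁻¹ := by
    rw [← mul_inv, mul_add, mul_inv_cancel₀ ht.ne', add_comm]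
  rw [h1, Real.exp_neg]
  exact inv_anti₀ (by positivity) (Real.add_one_le_exp _)

lemma integrable_exp_neg_mul_exp
    (hν : ∀ s : ℝ, 0 < s → ∫⁻ x, ENNReal.ofReal (s + Real.exp x)⁻¹ ∂ν ≠ ∞)
    {t : ℝ} (ht : 0 < t) : Integrable (fun x => Real.exp (-(t * Real.exp x))) ν := by
  refine ⟨by fun_prop, ?_⟩
  rw [hasFiniteIntegral_iff_ofReal (ae_of_all _ fun _ => (Real.exp_pos _).le)]
  exact (lintegral_exp_neg_mul_exp_le ht).trans_lt
    (ENNReal.mul_lt_top ENNReal.ofReal_lt_top (hν _ (inv_pos.2 ht)).lt_top)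

lemma laplaceDensity_nonneg (t : ℝ) : 0 ≤ laplaceDensity ν t :=
  integral_nonneg fun _ => (Real.exp_pos _).le

lemma ofReal_laplaceDensity
    (hν : ∀ s : ℝ, 0 < s → ∫⁻ x, ENNReal.ofReal (s + Real.exp x)⁻¹ ∂ν ≠ ∞)
    {t : ℝ} (ht : 0 < t) : ENNReal.ofReal (laplaceDensity ν t)
      = ∫⁻ x, ENNReal.ofReal (Real.exp (-(t * Real.exp x))) ∂ν :=
  ofReal_integral_eq_lintegral_ofReal (integrable_exp_neg_mul_exp hν ht)
    (ae_of_all _ fun _ => (Real.exp_pos _).le)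

lemma continuousAt_laplaceDensity
    (hν : ∀ s : ℝ, 0 < s → ∫⁻ x, ENNReal.ofReal (s + Real.exp x)⁻¹ ∂ν ≠ ∞)
    {t : ℝ} (ht : 0 < t) : ContinuousAt (laplaceDensity ν) t := by
  -- For r > t / 2 the integrand is dominated by its value at t / 2.
  refine continuousAt_of_dominated (bound := fun x => Real.exp (-(t / 2 * Real.exp x)))
    (.of_forall fun r => by fun_prop) ?_ (integrable_exp_neg_mul_exp hν (half_pos ht))
    (ae_of_all _ fun x => by fun_prop)
  filter_upwards [lt_mem_nhds (half_lt_self ht)] with r hr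
  refine ae_of_all _ fun x => ?_
  rw [Real.norm_of_nonneg (Real.exp_pos _).le]
  gcongr

/-- The Laplace transform of `laplaceDensity ν` is the Stieltjes transform of `ν`. -/
lemma lintegral_exp_mul_laplaceDensity [SFinite ν]
    (hν : ∀ s : ℝ, 0 < s → ∫⁻ x, ENNReal.ofReal (s + Real.exp x)⁻¹ ∂ν ≠ ∞)
    {s : ℝ} (hs : 0 < s) :
    ∫⁻ t in Ioi (0 : ℝ), ENNReal.ofReal (laplaceDensity ν t) * ENNReal.ofReal (Real.exp (-(s * t)))
      = ∫⁻ x, ENNReal.ofReal (s + Real.exp x)⁻¹ ∂ν := by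
  have h1 : ∀ t ∈ Ioi (0 : ℝ),
      ENNReal.ofReal (laplaceDensity ν t) * ENNReal.ofReal (Real.exp (-(s * t)))
        = ∫⁻ x, ENNReal.ofReal (Real.exp (-((s + Real.exp x) * t))) ∂ν := by
    intro t ht
    rw [ofReal_laplaceDensity hν ht, ← lintegral_mul_const _ (by fun_prop)]
    refine lintegral_congr fun x => ?_
    rw [← ENNReal.ofReal_mul (Real.exp_pos _).le, ← Real.exp_add]
    congr 2; ring
  rw [setLIntegral_congr_fun measurableSet_Ioi h1, lintegral_lintegral_swap (by fun_prop)]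
  refine lintegral_congr fun x => ?_
  rw [lintegral_exp_neg_mul_Ioi (by positivity)]
  simp

end LaplaceDensity

/-! ### The derivative of h and the bound -/

/-- `h(·, lam)` is differentiable, with derivative `-lam` times the completely monotone function
whose Laplace transform is `1 / (lam + ψ)`. -/
theorem IsSubordinator.hasDerivAt_hittingLaplace {Ω : Type*} [MeasurableSpace Ω] {P : Measure Ω}
    [IsProbabilityMeasure P] {W : ℝ≥0 → Ω → ℝ} {φ : Measure ℝ} (hW : IsSubordinator P W φ)
    (hψ : 0 < laplaceExponent φ 1) {lam : ℝ} (hlam : 0 < lam) {ν : Measure ℝ} [SFinite ν]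
    (hν : ∀ s : ℝ, 0 < s → ∫⁻ x, ENNReal.ofReal (s + Real.exp x)⁻¹ ∂ν
      = ENNReal.ofReal (lam + laplaceExponent φ s)⁻¹)
    {t : ℝ} (ht : 0 < t) :
    HasDerivAt (fun r => hittingLaplace P W r lam) (-(lam * laplaceDensity ν t)) t := by
  have hν' : ∀ s : ℝ, 0 < s → ∫⁻ x, ENNReal.ofReal (s + Real.exp x)⁻¹ ∂ν ≠ ∞ :=
    fun s hs => by rw [hν s hs]; exact ENNReal.ofReal_ne_top
  obtain ⟨M, hMp, hM0, hMh, hML⟩ := hW.exists_law_at_expClock hψ hlam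
  set g : ℝ → ℝ := fun r => lam * laplaceDensity ν r with hg
  have hgc : ContinuousOn g (Ioi 0) := fun r hr =>
    ((continuousAt_laplaceDensity hν' hr).const_mul lam).continuousWithinAt
  have hg0 : ∀ r, 0 ≤ g r := fun r => mul_nonneg hlam.le (laplaceDensity_nonneg r)
  have hgm : AEMeasurable (fun r => ENNReal.ofReal (g r)) (volume.restrict (Ioi 0)) :=
    (hgc.aemeasurable measurableSet_Ioi).ennreal_ofReal
  have hMeq : M = (volume.restrict (Ioi 0)).withDensity fun r => ENNReal.ofReal (g r) := by
    refine measure_ext_of_lintegral_exp hM0 ?_ ?_ fun n => ?_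
    · refine withDensity_absolutelyContinuous _ _ ?_
      rw [Measure.restrict_apply measurableSet_Iio]
      convert measure_empty (μ := (volume : Measure ℝ))
      ext x
      simp only [mem_inter_iff, mem_Iio, mem_Ioi, mem_empty_iff_false, iff_false, not_and, not_lt]
      exact fun h => h.le
    · have := hML 1 zero_le_one
      simp only [one_mul] at this
      rw [this]
      exact ENNReal.ofReal_ne_top
    · have hn : (0 : ℝ) < n + 1 := by positivity
      rw [hML _ hn.le, lintegral_withDensity_eq_lintegral_mul₀ hgm (by fun_prop)]
      simp only [Pi.mul_apply, hg, ENNReal.ofReal_mul hlam.le, mul_assoc]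
      rw [lintegral_const_mul' _ _ ENNReal.ofReal_ne_top, lintegral_exp_mul_laplaceDensity hν' hn,
        hν _ hn]
  -- The primitive is based at t / 2, since g is known to be continuous only on the open half line.
  have hq : 0 < t / 2 := half_pos ht
  have hint : ∀ r, t / 2 < r → IntervalIntegrable g volume (t / 2) r := fun r hr =>
    (hgc.mono fun x hx => by
      rw [uIcc_of_le hr.le] at hx
      exact hq.trans_le hx.1).intervalIntegrable
  have hform : ∀ r, t / 2 < r → hittingLaplace P W r lam
      = hittingLaplace P W (t / 2) lam - ∫ x in (t / 2)..r, g x := by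
    intro r hr
    have hsplit : M (Ioi (t / 2)) = M (Ioc (t / 2) r) + M (Ioi r) := by
      rw [← measure_union (Ioc_disjoint_Ioi le_rfl) measurableSet_Ioi, Ioc_union_Ioi_eq_Ioi hr.le]
    have hsub : Ioc (t / 2) r ⊆ Ioi 0 := fun x hx => hq.trans hx.1
    have hIoc : M (Ioc (t / 2) r) = ENNReal.ofReal (∫ x in (t / 2)..r, g x) := by
      rw [hMeq, withDensity_apply _ measurableSet_Ioc,
        Measure.restrict_restrict measurableSet_Ioc,
        inter_eq_left.2 hsub, intervalIntegral.integral_of_le hr.le,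
        ofReal_integral_eq_lintegral_ofReal ((intervalIntegrable_iff_integrableOn_Ioc_of_le
          hr.le).1 (hint r hr)) (ae_of_all _ hg0)]
    rw [hMh _ (hq.trans hr).le, hMh _ hq.le, hsplit,
      ENNReal.toReal_add (measure_ne_top _ _) (measure_ne_top _ _), hIoc,
      ENNReal.toReal_ofReal (intervalIntegral.integral_nonneg hr.le fun x _ => hg0 x)]
    ring
  have hlt : t / 2 < t := half_lt_self ht
  have hderiv := intervalIntegral.integral_hasDerivAt_right (hint t hlt)
    (hgc.stronglyMeasurableAtFilter isOpen_Ioi t ht)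
    (hgc.continuousAt (Ioi_mem_nhds ht))
  refine (hderiv.const_sub (hittingLaplace P W (t / 2) lam)).congr_of_eventuallyEq ?_
  filter_upwards [lt_mem_nhds hlt] with r hr using hform r hr

theorem mainTheorem4 {Ω : Type*} [MeasurableSpace Ω] (P : Measure Ω) [IsProbabilityMeasure P]
    (n : ℕ) (hn : 0 < n) (β c : Fin n → ℝ)
    (hβ : StrictMono β) (hβ01 : ∀ j, β j ∈ Ioo (0 : ℝ) 1) (hc : ∀ j, 0 < c j)
    (φ : Measure ℝ)
    (hφ : ∀ u : ℝ, 0 < u →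
      φ (Ioi u) = ∫⁻ b in Ioo (0 : ℝ) 1, ENNReal.ofReal (u ^ (-b)) ∂(atomicMixingMeasure β c))
    (W : ℝ≥0 → Ω → ℝ) (hW : IsSubordinator P W φ)
    (lam : ℝ) (hlam : 0 < lam) (t : ℝ) (ht : 0 < t) :
    DifferentiableAt ℝ (fun r => hittingLaplace P W r lam) t ∧
      ∀ j, |deriv (fun r => hittingLaplace P W r lam) t| ≤ lam * kernelBound (β j) (c j) t := by
  have : Nonempty (Fin n) := ⟨⟨0, hn⟩⟩
  have ha : ∀ j, 0 < c j ^ β j := fun j => Real.rpow_pos_of_pos (hc j) _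
  have hexpo : ∀ s : ℝ, 0 < s → laplaceExponent φ s = ∑ j, c j ^ β j * s ^ β j :=
    fun s hs => laplaceExponent_eq_sum hβ01 hc hφ hs
  have hψ : 0 < laplaceExponent φ 1 := by
    rw [hexpo 1 one_pos]
    exact Finset.sum_pos (fun j _ => by simpa using ha j) Finset.univ_nonempty
  obtain ⟨ν, hνs, hν⟩ := exists_stieltjes_measure hlam ha hβ01
  have hν1 : ∀ s : ℝ, 0 < s → ∫⁻ x, ENNReal.ofReal (s + Real.exp x)⁻¹ ∂ν
      = ENNReal.ofReal (lam + laplaceExponent φ s)⁻¹ := fun s hs => by rw [hν s hs, hexpo s hs]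
  have hderiv := hW.hasDerivAt_hittingLaplace hψ hlam hν1 ht
  refine ⟨hderiv.differentiableAt, fun j => ?_⟩
  rw [hderiv.deriv, abs_neg, abs_of_nonneg (mul_nonneg hlam.le (laplaceDensity_nonneg t))]
  refine mul_le_mul_of_nonneg_left ?_ hlam.le
  have hsum : ∀ i, 0 ≤ c i ^ β i * t⁻¹ ^ β i := fun i =>
    mul_nonneg (ha i).le (Real.rpow_nonneg (inv_nonneg.2 ht.le) _)
  have hpos : 0 < c j ^ β j * t⁻¹ ^ β j :=
    mul_pos (ha j) (Real.rpow_pos_of_pos (inv_pos.2 ht) _)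
  have hsin : 0 < Real.sin (β j * Real.pi) := Real.sin_pos_of_pos_of_lt_pi
    (mul_pos (hβ01 j).1 Real.pi_pos) (by nlinarith [Real.pi_pos, (hβ01 j).2])
  -- The Stieltjes transform at 1/t is explicit; dropping λ and every summand except the j-th leaves
  -- the power t^{β_j - 1}.
  calc laplaceDensity ν t ≤ t⁻¹ * (lam + ∑ i, c i ^ β i * t⁻¹ ^ β i)⁻¹ := by
        have hnn : 0 ≤ lam + ∑ i, c i ^ β i * t⁻¹ ^ β i :=
          add_nonneg hlam.le (Finset.sum_nonneg fun i _ => hsum i)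
        rw [← ENNReal.ofReal_le_ofReal_iff (by positivity), ENNReal.ofReal_mul (by positivity),
          ← hν _ (inv_pos.2 ht), ofReal_laplaceDensity
            (fun s hs => by rw [hν s hs]; exact ENNReal.ofReal_ne_top) ht]
        exact lintegral_exp_neg_mul_exp_le ht
    _ ≤ t⁻¹ * (c j ^ β j * t⁻¹ ^ β j)⁻¹ := by
        gcongr
        have := Finset.single_le_sum (fun i _ => hsum i) (Finset.mem_univ j)
        linarith
    _ = (c j ^ β j)⁻¹ * t ^ (β j - 1) := by
        rw [Real.inv_rpow ht.le, mul_inv, inv_inv, Real.rpow_sub_one ht.ne']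
        ring
    _ ≤ kernelBound (β j) (c j) t := by
        rw [kernelBound]
        refine mul_le_mul_of_nonneg_right ?_ (Real.rpow_nonneg ht.le _)
        -- The sine in the stated bound only enlarges it.
        exact inv_anti₀ (mul_pos (ha j) hsin)
          (mul_le_of_le_one_right (ha j).le (Real.sin_le_one _))
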